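/- **Corollary 1.6 (Hypergraph removal lemma, partite hypergraph version).** There is a function $c:\mathbb{N}\times(0,1]\to\mathbb{R}$ with $\lim_{\delta\to 0^+}c(n,\delta)=0$ for every fixed $n\in\mathbb{N}$, such that the following holds. Let $J$ be a finite set, let $(V_j)_{j\in J}$ be finite non-empty sets, let $0\le d\le |J|$, and let $H_d$ be a non-empty set of $d$-element subsets of $J$. For each $e\in H_d$ let $E_e\subseteq\prod_{j\in e}V_j$, and suppose that for some $0<\delta\le 1$ $$\Big|\Big\{(x_j)_{j\in J}\in\prod_{j\in J}V_j:\ (x_j)_{j\in e}\in E_e\text{ for all }e\in H_d\Big\}\Big|\le\delta\prod_{j\in J}|V_j|,$$ that is, the $J$-partite hypergraph $G=((V_j)_{j\in J},(E_e)_{e\in H_d})$ contains at most $\delta\prod_{j\in J}|V_j|$ copies of $H_d$. Then for each $e\in H_d$ there exists $E'_e\subseteq\prod_{j\in e}V_j$ such that $$\Big\{(x_j)_{j\in J}\in\prod_{j\in J}V_j:\ (x_j)_{j\in e}\in E'_e\text{ for all }e\in H_d\Big\}=\emptyset,$$ that is, the hypergraph $((V_j)_{j\in J},(E'_e)_{e\in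 H_d})$ contains no copies of $H_d$, and $$|E_e\setminus E'_e|\le c(|J|,\delta)\prod_{j\in e}|V_j|\qquad\text{for all }e\in H_d.$$ -/

import Mathlib

open Filter Topology

/-- The copies of `H` in the `J`-partite hypergraph with vertex classes `V j` and edge sets
`E e ⊆ ∏ j ∈ e, V j`: the points `x` of `∏ j, V j` such that, for every `e ∈ H`, the subtuple of
the coordinates of `x` indexed by `e` lies in `E e`. -/
def hypergraphCopies {J : Type*} {V : J → Type*} (H : Finset (Finset J))
    (E : ∀ e : {e : Finset J // e ∈ H}, Set (∀ j : {j : J // j ∈ e.1}, V j.1)) :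
    Set (∀ j, V j) :=
  {x | ∀ e : {e : Finset J // e ∈ H}, (fun j : {j : J // j ∈ e.1} => x j.1) ∈ E e}

/-! Fix the pattern and suppose that it has counterexamples with copy densities tending to zero.
Internal subsets of their product vertex spaces carry a Loeb probability measure whose values are
limits of densities along an ultrafilter. The edge sets become internal sets, each depending on the
coordinates in its `e`, and their intersection is null. It suffices to replace them by internal sets
with empty intersection, losing little measure, and to read this off at one index.

The analytic input is relative independence (`setIntegral_condExp_of_subfamily`): integrals of a
function of the coordinates in `e` against sets built from other coordinate subsets `k` only see its
conditional expectation on the lower-order σ-algebra of the intersections `k ∩ e`. At a finite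
stage, freezing the coordinates off `e` at a good value turns `k`-cylinders into `(k ∩
e)`-cylinders.

The removal itself (`exists_internal_removal`) is an induction on order. Each set is approximated by
cells of a finite coloring of `r`-sets of coordinates. Cells where the set has low conditional
density, and colors of low conditional density, are discarded. The regions where the densities are
high are measurable one order lower, so the induction hypothesis makes them internal. A common point
of the surviving sets then yields a positive-measure intersection of these regions. Relative
independence allows the color classes through the point to be inserted one by one while the measure
stays positive, and in the resulting cell the original sets have such small defects that they must
meet in positive measure. -/

open MeasureTheory Set ENNReal

/-! ### Loeb measure on a sequence of finite sets -/

/-- The product of a sequence of types, without the quotient by an ultrafilter. -/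
def LoebPoint (W : ℕ → Type*) : Type _ := ∀ n, W n

section Loeb

variable {W : ℕ → Type*}

/-- The ultraproduct of a sequence of sets, as a subset of the product. -/
def internalSet (A : ∀ n, Set (W n)) : Set (LoebPoint W) :=
  {x | ∀ᶠ n in (hyperfilter ℕ : Filter ℕ), x n ∈ A n}

theorem mem_internalSet {A : ∀ n, Set (W n)} {x : LoebPoint W} :
    x ∈ internalSet A ↔ ∀ᶠ n in (hyperfilter ℕ : Filter ℕ), x n ∈ A n := Iff.rfl

theorem internalSet_compl (A : ∀ n, Set (W n)) :
    (internalSet A)ᶜ = internalSet fun n => (A n)ᶜ := by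
  ext x
  simp only [mem_compl_iff, mem_internalSet]
  exact Ultrafilter.eventually_not.symm

theorem internalSet_inter (A B : ∀ n, Set (W n)) :
    internalSet A ∩ internalSet B = internalSet fun n => A n ∩ B n := by
  ext x
  simp only [mem_inter_iff, mem_internalSet]
  exact eventually_and.symm

theorem internalSet_union (A B : ∀ n, Set (W n)) :
    internalSet A ∪ internalSet B = internalSet fun n => A n ∪ B n := by
  ext x
  simp only [mem_union, mem_internalSet]
  exact Ultrafilter.eventually_or.symm

theorem internalSet_diff (A B : ∀ n, Set (W n)) :
    internalSet A \ internalSet B = internalSet fun n => A n \ B n := by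
  rw [sdiff_eq, internalSet_compl, internalSet_inter]; rfl

theorem internalSet_biInter {ι : Type*} (s : Finset ι) (A : ι → ∀ n, Set (W n)) :
    ⋂ i ∈ s, internalSet (A i) = internalSet fun n => ⋂ i ∈ s, A i n := by
  ext x
  simp only [mem_iInter, mem_internalSet]
  rw [Filter.eventually_all_finset]

theorem internalSet_univ : internalSet (fun n => (univ : Set (W n))) = univ := by
  ext x; simp [mem_internalSet]

theorem internalSet_empty : internalSet (fun n => (∅ : Set (W n))) = ∅ := by
  ext x
  simp [mem_internalSet, (hyperfilter ℕ).neBot.ne]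

theorem isSetAlgebra_range_internalSet :
    IsSetAlgebra (range (internalSet (W := W))) where
  empty_mem := ⟨_, internalSet_empty⟩
  compl_mem := by
    rintro _ ⟨A, rfl⟩; exact ⟨_, (internalSet_compl A).symm⟩
  union_mem := by
    rintro _ _ ⟨A, rfl⟩ ⟨B, rfl⟩; exact ⟨_, (internalSet_union A B).symm⟩

instance : MeasurableSpace (LoebPoint W) :=
  MeasurableSpace.generateFrom (range (internalSet (W := W)))

theorem measurableSet_internalSet (A : ∀ n, Set (W n)) : MeasurableSet (internalSet A) :=
  MeasurableSpace.measurableSet_generateFrom ⟨A, rfl⟩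

variable [∀ n, Nonempty (W n)]

/-- A sequence choosing a point of `A n \ B n` whenever possible would violate the inclusion. Hence
an internal set determines its sequence of sets up to the ultrafilter, and limiting densities are
well defined. -/
theorem eventually_subset_of_internalSet_subset {A B : ∀ n, Set (W n)}
    (h : internalSet A ⊆ internalSet B) :
    ∀ᶠ n in (hyperfilter ℕ : Filter ℕ), A n ⊆ B n := by
  classical
  have : ∀ n, ∃ x : W n, (A n ⊆ B n) ∨ (x ∈ A n ∧ x ∉ B n) := by
    intro n
    by_cases h' : A n ⊆ B n
    · exact ⟨Classical.arbitrary _, Or.inl h'⟩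
    · obtain ⟨x, hx⟩ := not_subset.1 h'
      exact ⟨x, Or.inr hx⟩
  choose x hx using this
  by_cases hA : ∀ᶠ n in (hyperfilter ℕ : Filter ℕ), x n ∈ A n
  · have hB : ∀ᶠ n in (hyperfilter ℕ : Filter ℕ), x n ∈ B n := @h x hA
    filter_upwards [hB] with n hn
    rcases hx n with h1 | h1
    · exact h1
    · exact absurd hn h1.2
  · filter_upwards [Ultrafilter.eventually_not.2 hA] with n hn
    rcases hx n with h1 | h1
    · exact h1
    · exact absurd h1.1 hn

theorem eventually_eq_empty_of_internalSet_eq_empty {A : ∀ n, Set (W n)}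
    (h : internalSet A = ∅) : ∀ᶠ n in (hyperfilter ℕ : Filter ℕ), A n = ∅ := by
  have := eventually_subset_of_internalSet_subset (A := A) (B := fun n => ∅)
    (by rw [h]; exact empty_subset _)
  filter_upwards [this] with n hn
  exact subset_empty_iff.1 hn

/-- Countable saturation for internal sets. -/
theorem iInter_internalSet_nonempty (A : ℕ → ∀ n, Set (W n))
    (hA : ∀ k, (⋂ i ∈ Finset.range (k + 1), internalSet (A i)).Nonempty) :
    (⋂ k, internalSet (A k)).Nonempty := by
  classical
  have hne : ∀ k, ∀ᶠ n in (hyperfilter ℕ : Filter ℕ),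
      (⋂ i ∈ Finset.range (k + 1), A i n).Nonempty := by
    intro k
    obtain ⟨x, hx⟩ := hA k
    rw [internalSet_biInter] at hx
    filter_upwards [hx] with n hn using ⟨_, hn⟩
  -- Diagonal choice: `x n` lies in the deepest nonempty partial intersection of depth at most `n`.
  -- The bound `k ≤ n` ensures that a deepest one exists.
  let P : ℕ → ℕ → Prop := fun n k => k ≤ n ∧ (⋂ i ∈ Finset.range (k + 1), A i n).Nonempty
  have : ∀ n, ∃ x : W n, ∀ k, P n k → (∀ j, P n j → j ≤ k) →
      x ∈ ⋂ i ∈ Finset.range (k + 1), A i n := by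
    intro n
    by_cases h : ∃ k, P n k ∧ ∀ j, P n j → j ≤ k
    · obtain ⟨k, hk, hmax⟩ := h
      obtain ⟨x, hx⟩ := hk.2
      refine ⟨x, fun k' hk' hmax' => ?_⟩
      have : k' = k := le_antisymm (hmax _ hk') (hmax' _ hk)
      rwa [this]
    · exact ⟨Classical.arbitrary _, fun k hk hmax => absurd ⟨k, hk, hmax⟩ h⟩
  choose x hx using this
  refine ⟨x, mem_iInter.2 fun k => ?_⟩
  have hge : ∀ᶠ n in (hyperfilter ℕ : Filter ℕ), k ≤ n :=
    Filter.Tendsto.eventually_ge_atTop Nat.hyperfilter_le_atTop k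
  refine mem_internalSet.2 ?_
  filter_upwards [hne k, hge] with n hn hkn
  have hP : P n k := ⟨hkn, hn⟩
  have hmax := Nat.findGreatest_spec (P := P n) hkn hP
  have hle := Nat.le_findGreatest (P := P n) hkn hP
  have := hx n _ hmax (fun j hj => Nat.le_findGreatest hj.1 hj)
  simp only [mem_iInter, Finset.mem_range] at this
  exact this k (by omega)

variable [∀ n, Fintype (W n)]

/-- The proportion of a finite type filled by a set. -/
noncomputable def setDensity {T : Type*} [Fintype T] (A : Set T) : ℝ≥0∞ :=
  (A.ncard : ℝ≥0∞) / Fintype.card T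

theorem setDensity_union {T : Type*} [Fintype T] {A B : Set T} (h : Disjoint A B) :
    setDensity (A ∪ B) = setDensity A + setDensity B := by
  simp only [setDensity]
  rw [ncard_union_eq h (toFinite _) (toFinite _), Nat.cast_add, ENNReal.add_div]

theorem setDensity_univ {T : Type*} [Fintype T] [Nonempty T] :
    setDensity (univ : Set T) = 1 := by
  simp only [setDensity, ncard_univ, Nat.card_eq_fintype_card]
  exact ENNReal.div_self (by simp) (by simp)

theorem setDensity_empty {T : Type*} [Fintype T] : setDensity (∅ : Set T) = 0 := by
  simp [setDensity]

/-- The limit along the hyperfilter of a sequence of extended nonnegative reals. -/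
noncomputable def hyperLim (f : ℕ → ℝ≥0∞) : ℝ≥0∞ := ((hyperfilter ℕ).map f).lim

theorem tendsto_hyperLim (f : ℕ → ℝ≥0∞) :
    Tendsto f (hyperfilter ℕ : Filter ℕ) (𝓝 (hyperLim f)) :=
  Ultrafilter.le_nhds_lim ((hyperfilter ℕ).map f)

theorem hyperLim_eq {f : ℕ → ℝ≥0∞} {a : ℝ≥0∞}
    (h : Tendsto f (hyperfilter ℕ : Filter ℕ) (𝓝 a)) : hyperLim f = a :=
  tendsto_nhds_unique (tendsto_hyperLim f) h

open Classical in
/-- The limiting density of an internal set (and `0` for other sets). -/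
noncomputable def loebFun (S : Set (LoebPoint W)) : ℝ≥0∞ :=
  if h : ∃ A, internalSet A = S then hyperLim fun n => setDensity (h.choose n) else 0

theorem loebFun_internalSet (A : ∀ n, Set (W n)) :
    loebFun (internalSet A) = hyperLim fun n => setDensity (A n) := by
  have h : ∃ B, internalSet B = internalSet A := ⟨A, rfl⟩
  rw [loebFun, dif_pos h]
  apply hyperLim_eq
  refine (tendsto_hyperLim fun n => setDensity (A n)).congr' ?_
  have h1 := eventually_subset_of_internalSet_subset h.choose_spec.le
  have h2 := eventually_subset_of_internalSet_subset h.choose_spec.ge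
  filter_upwards [h1, h2] with n h1 h2
  rw [Subset.antisymm h1 h2]

/-- The finitely additive content underlying the Loeb measure. -/
noncomputable def loebContent : AddContent ℝ≥0∞ (range (internalSet (W := W))) :=
  isSetAlgebra_range_internalSet.isSetRing.addContent_of_union loebFun
    (by
      rw [← internalSet_empty, loebFun_internalSet]
      apply hyperLim_eq
      simp [setDensity_empty])
    (by
      rintro _ _ ⟨A, rfl⟩ ⟨B, rfl⟩ hAB
      rw [internalSet_union]
      simp only [loebFun_internalSet]
      apply hyperLim_eq
      refine ((tendsto_hyperLim _).add (tendsto_hyperLim _)).congr' ?_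
      rw [disjoint_iff_inter_eq_empty, internalSet_inter] at hAB
      filter_upwards [eventually_eq_empty_of_internalSet_eq_empty hAB] with n hn
      rw [setDensity_union (disjoint_iff_inter_eq_empty.2 hn)])

theorem loebContent_internalSet (A : ∀ n, Set (W n)) :
    loebContent (internalSet A) = hyperLim fun n => setDensity (A n) :=
  loebFun_internalSet A

/-- By saturation, a decreasing sequence of internal sets with empty intersection is eventually
empty, so continuity at `∅` is automatic. -/
theorem loebContent_isSigmaSubadditive :
    (loebContent (W := W)).IsSigmaSubadditive := by
  apply isSigmaSubadditive_of_addContent_iUnion_eq_tsum isSetAlgebra_range_internalSet.isSetRing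
  apply addContent_iUnion_eq_sum_of_tendsto_zero isSetAlgebra_range_internalSet.isSetRing
  · rintro _ ⟨A, rfl⟩
    rw [loebContent_internalSet]
    refine ne_top_of_le_ne_top (b := 1) (by simp) ?_
    refine le_of_tendsto (tendsto_hyperLim _) (Eventually.of_forall fun n => ?_)
    rw [← setDensity_univ (T := W n)]
    simp only [setDensity]
    gcongr
    · exact toFinite _
    · exact subset_univ _
  · intro s hs hanti hemp
    choose A hA using hs
    have : ∃ k, s k = ∅ := by
      by_contra! hne
      obtain ⟨x, hx⟩ := iInter_internalSet_nonempty A (fun k => by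
        refine (hne k).mono ?_
        simp only [hA]
        refine subset_iInter₂ fun i hi => hanti ?_
        simp only [Finset.mem_range] at hi
        omega)
      simp only [hA] at hx
      rw [hemp] at hx
      exact hx
    obtain ⟨k, hk⟩ := this
    apply tendsto_const_nhds.congr'
    filter_upwards [eventually_ge_atTop k] with n hn
    have : s n = ∅ := subset_empty_iff.1 (hk ▸ hanti hn)
    rw [this, addContent_empty]

/-- The Loeb measure. -/
noncomputable def loebMeasure : Measure (LoebPoint W) :=
  loebContent.measure isSetAlgebra_range_internalSet.isSetRing.isSetSemiring le_rfl
    loebContent_isSigmaSubadditive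

theorem loebMeasure_internalSet (A : ∀ n, Set (W n)) :
    loebMeasure (internalSet A) = hyperLim fun n => setDensity (A n) := by
  rw [loebMeasure, AddContent.measure_eq _ _ rfl _ (mem_range_self A), loebContent_internalSet]

instance : IsProbabilityMeasure (loebMeasure (W := W)) where
  measure_univ := by
    rw [← internalSet_univ, loebMeasure_internalSet]
    apply hyperLim_eq
    simp [setDensity_univ]

theorem tendsto_density (A : ∀ n, Set (W n)) :
    Tendsto (fun n => ((A n).ncard : ℝ) / Fintype.card (W n)) (hyperfilter ℕ : Filter ℕ)
      (𝓝 (loebMeasure.real (internalSet A))) := by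
  have h := tendsto_hyperLim fun n => setDensity (A n)
  rw [← loebMeasure_internalSet] at h
  have := (ENNReal.tendsto_toReal (measure_ne_top loebMeasure _)).comp h
  refine this.congr fun n => ?_
  simp [setDensity, ENNReal.toReal_div]

end Loeb

/-! ### Cylinders and the associated sub-σ-algebras -/

section Cylinder

variable {J : Type*} {T : J → Type*}

/-- A set of tuples depends only on the coordinates in `e`. -/
def IsCylinder (e : Finset J) (A : Set (∀ j, T j)) : Prop :=
  ∀ ⦃x y⦄, (∀ j ∈ e, x j = y j) → x ∈ A → y ∈ A

theorem IsCylinder.compl {e : Finset J} {A : Set (∀ j, T j)} (h : IsCylinder e A) :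
    IsCylinder e Aᶜ := fun _ _ hxy hx hy => hx (h (fun j hj => (hxy j hj).symm) hy)

theorem IsCylinder.inter {e : Finset J} {A B : Set (∀ j, T j)} (hA : IsCylinder e A)
    (hB : IsCylinder e B) : IsCylinder e (A ∩ B) :=
  fun _ _ hxy hx => ⟨hA hxy hx.1, hB hxy hx.2⟩

theorem IsCylinder.union {e : Finset J} {A B : Set (∀ j, T j)} (hA : IsCylinder e A)
    (hB : IsCylinder e B) : IsCylinder e (A ∪ B) :=
  fun _ _ hxy hx => hx.imp (hA hxy) (hB hxy)

theorem IsCylinder.mono {e f : Finset J} {A : Set (∀ j, T j)} (h : IsCylinder e A) (hef : e ⊆ f) :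
    IsCylinder f A := fun _ _ hxy hx => h (fun j hj => hxy j (hef hj)) hx

theorem isCylinder_univ (e : Finset J) : IsCylinder e (univ : Set (∀ j, T j)) :=
  fun _ _ _ _ => trivial

theorem IsCylinder.mem_iff {e : Finset J} {A : Set (∀ j, T j)} (h : IsCylinder e A)
    {x y : ∀ j, T j} (hxy : ∀ j ∈ e, x j = y j) : x ∈ A ↔ y ∈ A :=
  ⟨h hxy, h fun j hj => (hxy j hj).symm⟩

variable [DecidableEq J]

/-- The tuple equal to `x` on `e` and to `y` off `e`. -/
def glue (e : Finset J) (x y : ∀ j, T j) : ∀ j, T j := fun j => if j ∈ e then x j else y j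

theorem glue_of_mem {e : Finset J} (x y : ∀ j, T j) {j : J} (hj : j ∈ e) :
    glue e x y j = x j := if_pos hj

theorem isCylinder_preimage_glue {e k : Finset J} {A : Set (∀ j, T j)} (h : IsCylinder k A)
    (y : ∀ j, T j) : IsCylinder (k ∩ e) {x | glue e x y ∈ A} := by
  intro x x' hxx' hx
  refine h (fun j hj => ?_) hx
  by_cases hje : j ∈ e
  · simp [glue, hje, hxx' j (Finset.mem_inter.2 ⟨hj, hje⟩)]
  · simp [glue, hje]

theorem sum_sum_glue [Fintype J] [∀ j, Fintype (T j)] (e : Finset J)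
    (G : (∀ j, T j) → ℝ) :
    ∑ y, ∑ x, G (glue e x y) = Fintype.card (∀ j, T j) * ∑ x, G x := by
  have hinv : ∀ x y : ∀ j, T j, glue e (glue e x y) (glue e y x) = x := by
    intro x y; funext j; by_cases hj : j ∈ e <;> simp [glue, hj]
  -- Exchanging the coordinates of `x` and `y` off `e` is an involution of pairs.
  let φ : (∀ j, T j) × (∀ j, T j) ≃ (∀ j, T j) × (∀ j, T j) :=
    { toFun := fun p => (glue e p.1 p.2, glue e p.2 p.1)
      invFun := fun p => (glue e p.1 p.2, glue e p.2 p.1)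
      left_inv := fun p => by simp [hinv]
      right_inv := fun p => by simp [hinv] }
  rw [Finset.sum_comm, ← Fintype.sum_prod_type' (f := fun x y => G (glue e x y))]
  rw [show (∑ p : (∀ j, T j) × (∀ j, T j), G (glue e p.1 p.2)) = ∑ p, G (φ p).1 from rfl,
    Equiv.sum_comp φ fun p => G p.1, Fintype.sum_prod_type]
  simp [Finset.mul_sum]

/-- The full sum is the average over `y` of the sums with coordinates off `e` frozen at `y`, so some
`y` does at least as well as the average. -/
theorem exists_abs_sum_le_abs_sum_glue [Fintype J] [∀ j, Fintype (T j)] [∀ j, Nonempty (T j)]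
    (e : Finset J) (G : (∀ j, T j) → ℝ) :
    ∃ y, |∑ x, G x| ≤ |∑ x, G (glue e x y)| := by
  by_contra! h
  have hcard : (0 : ℝ) < Fintype.card (∀ j, T j) := by exact_mod_cast Fintype.card_pos
  have h1 := sum_sum_glue e G
  have h2 : |∑ y, ∑ x, G (glue e x y)| < Fintype.card (∀ j, T j) * |∑ x, G x| := by
    refine (Finset.abs_sum_le_sum_abs _ _).trans_lt ?_
    refine (Finset.sum_lt_sum_of_nonempty Finset.univ_nonempty fun y _ => h y).trans_le ?_
    simp
  rw [h1, abs_mul, abs_of_pos hcard] at h2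
  exact lt_irrefl _ h2

end Cylinder

/-! ### σ-algebras generated by coordinate subsets -/

section Sigma

variable {J : Type*} {V : ℕ → J → Type*}

/-- An internal set of sequences of tuples depending only on the coordinates in `e`. -/
def IsInternal (e : Finset J) (X : Set (LoebPoint fun n => ∀ j, V n j)) : Prop :=
  ∃ A : ∀ n, Set (∀ j, V n j), (∀ n, IsCylinder e (A n)) ∧ internalSet A = X

theorem IsInternal.compl {e : Finset J} {X : Set (LoebPoint fun n => ∀ j, V n j)}
    (h : IsInternal e X) : IsInternal e Xᶜ := by
  obtain ⟨A, hA, rfl⟩ := h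
  exact ⟨_, fun n => (hA n).compl, (internalSet_compl A).symm⟩

theorem IsInternal.inter {e : Finset J} {X Y : Set (LoebPoint fun n => ∀ j, V n j)}
    (hX : IsInternal e X) (hY : IsInternal e Y) : IsInternal e (X ∩ Y) := by
  obtain ⟨A, hA, rfl⟩ := hX
  obtain ⟨B, hB, rfl⟩ := hY
  exact ⟨_, fun n => (hA n).inter (hB n), (internalSet_inter A B).symm⟩

theorem IsInternal.union {e : Finset J} {X Y : Set (LoebPoint fun n => ∀ j, V n j)}
    (hX : IsInternal e X) (hY : IsInternal e Y) : IsInternal e (X ∪ Y) := by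
  obtain ⟨A, hA, rfl⟩ := hX
  obtain ⟨B, hB, rfl⟩ := hY
  exact ⟨_, fun n => (hA n).union (hB n), (internalSet_union A B).symm⟩

theorem IsInternal.mono {e f : Finset J} {X : Set (LoebPoint fun n => ∀ j, V n j)}
    (h : IsInternal e X) (hef : e ⊆ f) : IsInternal f X := by
  obtain ⟨A, hA, rfl⟩ := h
  exact ⟨A, fun n => (hA n).mono hef, rfl⟩

theorem isInternal_univ (e : Finset J) :
    IsInternal e (univ : Set (LoebPoint fun n => ∀ j, V n j)) :=
  ⟨_, fun _ => isCylinder_univ e, internalSet_univ⟩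

theorem isInternal_empty (e : Finset J) :
    IsInternal e (∅ : Set (LoebPoint fun n => ∀ j, V n j)) := by
  simpa using (isInternal_univ (V := V) e).compl

theorem IsInternal.iInter {ι : Type*} [Finite ι] {e : Finset J}
    {X : ι → Set (LoebPoint fun n => ∀ j, V n j)} (h : ∀ i, IsInternal e (X i)) :
    IsInternal e (⋂ i, X i) := by
  choose A hA hX using h
  refine ⟨fun n => ⋂ i, A i n, fun n x y hxy hx => ?_, ?_⟩
  · simp only [mem_iInter] at hx ⊢
    exact fun i => hA i n hxy (hx i)
  · ext x
    simp only [mem_iInter, ← hX, mem_internalSet]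
    exact eventually_all

theorem IsInternal.iUnion {ι : Type*} [Finite ι] {e : Finset J}
    {X : ι → Set (LoebPoint fun n => ∀ j, V n j)} (h : ∀ i, IsInternal e (X i)) :
    IsInternal e (⋃ i, X i) := by
  rw [← compl_compl (⋃ i, X i), compl_iUnion]
  exact (IsInternal.iInter fun i => (h i).compl).compl

theorem IsInternal.measurableSet {e : Finset J} {X : Set (LoebPoint fun n => ∀ j, V n j)}
    (h : IsInternal e X) : MeasurableSet X := by
  obtain ⟨A, -, rfl⟩ := h
  exact measurableSet_internalSet A

/-- The σ-algebra generated by the internal sets depending only on the coordinates in `k`, for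
`k ∈ S`. -/
@[reducible] def loebSigma (V : ℕ → J → Type*) (S : Set (Finset J)) :
    MeasurableSpace (LoebPoint fun n => ∀ j, V n j) :=
  MeasurableSpace.generateFrom {X | ∃ k ∈ S, IsInternal k X}

theorem loebSigma_le (S : Set (Finset J)) :
    loebSigma V S ≤ (inferInstance : MeasurableSpace (LoebPoint fun n => ∀ j, V n j)) :=
  MeasurableSpace.generateFrom_le fun _ ⟨_, _, hX⟩ => hX.measurableSet

theorem IsInternal.measurableSet_loebSigma {S : Set (Finset J)} {k k' : Finset J}
    {X : Set (LoebPoint fun n => ∀ j, V n j)} (h : IsInternal k X) (hk : k' ∈ S) (hkk' : k ⊆ k') :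
    MeasurableSet[loebSigma V S] X :=
  MeasurableSpace.measurableSet_generateFrom ⟨k', hk, h.mono hkk'⟩

theorem loebSigma_mono {S S' : Set (Finset J)} (h : ∀ k ∈ S, ∃ k' ∈ S', k ⊆ k') :
    loebSigma V S ≤ loebSigma V S' := by
  refine MeasurableSpace.generateFrom_le fun X ⟨k, hk, hX⟩ => ?_
  obtain ⟨k', hk', hkk'⟩ := h k hk
  exact hX.measurableSet_loebSigma hk' hkk'

theorem isSetAlgebra_isInternal (e : Finset J) :
    IsSetAlgebra {X : Set (LoebPoint fun n => ∀ j, V n j) | IsInternal e X} where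
  empty_mem := isInternal_empty e
  compl_mem _ h := IsInternal.compl h
  union_mem _ _ h h' := IsInternal.union h h'

theorem loebSigma_singleton (e : Finset J) :
    loebSigma V {e} = MeasurableSpace.generateFrom
      {X : Set (LoebPoint fun n => ∀ j, V n j) | IsInternal e X} := by
  simp [loebSigma]

theorem exists_measure_symmDiff_lt_of_isSetAlgebra {X : Type*} {m : MeasurableSpace X}
    (μ : Measure X) [IsFiniteMeasure μ] {𝒜 : Set (Set X)} (h𝒜 : IsSetAlgebra 𝒜)
    (hgen : m = MeasurableSpace.generateFrom 𝒜) {s : Set X} (hs : MeasurableSet s) {ε : ℝ}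
    (hε : 0 < ε) : ∃ t ∈ 𝒜, μ (symmDiff s t) < ENNReal.ofReal ε :=
  (Measure.MeasureDense.of_generateFrom_isSetAlgebra_finite μ h𝒜 hgen).approx s hs
    (measure_ne_top _ _) ε hε

variable [Fintype J] [∀ n j, Fintype (V n j)] [∀ n j, Nonempty (V n j)] [DecidableEq J]

/-- `g` is measurable with respect to the coordinates in `e`, and its integrals over internal sets
are limits of averages of functions on the finite models. -/
structure IsInternalSimple (e : Finset J) (g : (LoebPoint fun n => ∀ j, V n j) → ℝ) : Prop where
  stronglyMeasurable : StronglyMeasurable[loebSigma V {e}] g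
  integrable : Integrable g loebMeasure
  exists_lift : ∃ G : ∀ n, (∀ j, V n j) → ℝ,
    (∀ n x y, (∀ j ∈ e, x j = y j) → G n x = G n y) ∧
    ∀ B : ∀ n, Set (∀ j, V n j),
      Tendsto (fun n => (∑ x, (B n).indicator (G n) x) / Fintype.card (∀ j, V n j))
        (hyperfilter ℕ : Filter ℕ) (𝓝 (∫ x in internalSet B, g x ∂loebMeasure))

theorem IsInternalSimple.add {e : Finset J} {f g : (LoebPoint fun n => ∀ j, V n j) → ℝ}
    (hf : IsInternalSimple e f) (hg : IsInternalSimple e g) : IsInternalSimple e (f + g) := by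
  obtain ⟨F, hF, hF'⟩ := hf.exists_lift
  obtain ⟨G, hG, hG'⟩ := hg.exists_lift
  refine ⟨hf.1.add hg.1, hf.2.add hg.2, fun n => F n + G n, fun n x y hxy => ?_, fun B => ?_⟩
  · simp [hF n x y hxy, hG n x y hxy]
  · simp only [Pi.add_apply]
    rw [integral_add hf.2.integrableOn hg.2.integrableOn]
    refine ((hF' B).add (hG' B)).congr fun n => ?_
    rw [← add_div, ← Finset.sum_add_distrib, indicator_add']
    rfl

theorem IsInternal.isInternalSimple_indicator {e : Finset J}
    {X : Set (LoebPoint fun n => ∀ j, V n j)} (h : IsInternal e X) (c : ℝ) :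
    IsInternalSimple e (X.indicator fun _ => c) := by
  classical
  have hm := h.measurableSet
  refine ⟨stronglyMeasurable_const.indicator
    (h.measurableSet_loebSigma (mem_singleton e) subset_rfl),
    (integrable_const c).indicator hm, ?_⟩
  obtain ⟨A, hA, rfl⟩ := h
  refine ⟨fun n => (A n).indicator fun _ => c, fun n x y hxy => ?_, fun B => ?_⟩
  · simp only [indicator, (hA n).mem_iff hxy]
  · rw [setIntegral_indicator hm, setIntegral_const, internalSet_inter, smul_eq_mul]
    refine ((tendsto_density fun n => B n ∩ A n).mul_const c).congr fun n => ?_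
    rw [div_mul_eq_mul_div]
    congr 1
    simp only [indicator_indicator]
    rw [Finset.sum_indicator_eq_sum_filter]
    simp only [Finset.sum_const, nsmul_eq_mul]
    congr 2
    rw [ncard_eq_toFinset_card']
    congr 1
    ext x; simp

theorem exists_isInternalSimple_integral_abs_sub_le {e : Finset J}
    {g : (LoebPoint fun n => ∀ j, V n j) → ℝ} (hg : StronglyMeasurable[loebSigma V {e}] g)
    (hgi : Integrable g loebMeasure) {ε : ℝ} (hε : 0 < ε) :
    ∃ ψ, IsInternalSimple e ψ ∧ ∫ x, |g x - ψ x| ∂loebMeasure ≤ ε := by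
  have hle : loebSigma V {e} ≤ _ := loebSigma_le {e}
  have hgm : MemLp g 1 (loebMeasure.trim hle) :=
    memLp_one_iff_integrable.2 (hgi.trim hle hg)
  obtain ⟨ψ, hψ, hψ'⟩ := @MemLp.induction_dense _ ℝ (loebSigma V {e}) _ 1 (loebMeasure.trim hle)
    (by simp) (IsInternalSimple e)
    (by
      -- Internal `e`-sets form an algebra generating the σ-algebra, so they approximate its sets in
      -- measure; indicators then suffice for density in L¹.
      intro c s hs _ ε hε
      obtain ⟨δ, hδ, hδ'⟩ := exists_eLpNorm_indicator_le (p := 1)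
        (μ := loebMeasure.trim hle) (by simp) c hε
      obtain ⟨t, ht, hst⟩ := exists_measure_symmDiff_lt_of_isSetAlgebra (loebMeasure.trim hle)
        (isSetAlgebra_isInternal e) (loebSigma_singleton e) hs (by exact_mod_cast hδ : (0 : ℝ) < δ)
      refine ⟨t.indicator fun _ => c, ?_, IsInternal.isInternalSimple_indicator ht c⟩
      rw [eLpNorm_indicator_sub_indicator]
      refine hδ' _ ?_
      rw [symmDiff_comm]
      exact hst.le.trans (by simp))
    (fun f g hf hg => hf.add hg) (fun f hf => hf.stronglyMeasurable.aestronglyMeasurable) g hgm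
    (ENNReal.ofReal ε) (by simpa using hε)
  refine ⟨ψ, hψ', ?_⟩
  rw [eLpNorm_trim hle (hg.sub hψ'.stronglyMeasurable), eLpNorm_one_eq_lintegral_enorm] at hψ
  have hi : Integrable (g - ψ) loebMeasure := hgi.sub hψ'.integrable
  rw [← ofReal_integral_norm_eq_lintegral_enorm hi] at hψ
  exact (ENNReal.ofReal_le_ofReal_iff hε.le).1 hψ

end Sigma

/-! ### Relative independence of coordinate σ-algebras -/

section Independence

variable {J : Type*} {V : ℕ → J → Type*}

/-- The intersections of one internal set for each index set in `S`. -/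
def internalBoxes (V : ℕ → J → Type*) (S : Set (Finset J)) :
    Set (Set (LoebPoint fun n => ∀ j, V n j)) :=
  {X | ∃ Y : S → Set (LoebPoint fun n => ∀ j, V n j), (∀ k, IsInternal k.1 (Y k)) ∧ ⋂ k, Y k = X}

theorem isPiSystem_internalBoxes (S : Set (Finset J)) : IsPiSystem (internalBoxes V S) := by
  rintro _ ⟨Y, hY, rfl⟩ _ ⟨Z, hZ, rfl⟩ -
  exact ⟨fun k => Y k ∩ Z k, fun k => (hY k).inter (hZ k), iInter_inter_distrib _ _⟩

variable [Fintype J]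

theorem loebSigma_eq_generateFrom_internalBoxes (S : Set (Finset J)) :
    loebSigma V S = MeasurableSpace.generateFrom (internalBoxes V S) := by
  classical
  refine le_antisymm (MeasurableSpace.generateFrom_le ?_) (MeasurableSpace.generateFrom_le ?_)
  · rintro X ⟨k, hk, hX⟩
    refine MeasurableSpace.measurableSet_generateFrom
      ⟨fun k' => if k'.1 = k then X else univ, fun k' => ?_, ?_⟩
    · by_cases h : k'.1 = k
      · simpa [h] using hX
      · simpa [h] using isInternal_univ _
    · ext x
      simp only [mem_iInter]
      refine ⟨fun h => by simpa using h ⟨k, hk⟩, fun hx k' => ?_⟩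
      split_ifs
      exacts [hx, trivial]
  · rintro _ ⟨Y, hY, rfl⟩
    exact MeasurableSet.iInter fun k => (hY k).measurableSet_loebSigma k.2 subset_rfl

variable [∀ n j, Fintype (V n j)] [∀ n j, Nonempty (V n j)] [DecidableEq J]

/-- At each finite stage the coordinates off `e` are frozen at a value that does not decrease the
absolute sum. The lift of `ψ` is unaffected, while each `k`-cylinder of the box becomes a `(k ∩
e)`-cylinder; the inequality survives the limit. -/
theorem IsInternalSimple.exists_abs_setIntegral_le {e : Finset J} {S S' : Set (Finset J)}
    (hS : ∀ k ∈ S, ∃ k' ∈ S', k ∩ e ⊆ k') {ψ : (LoebPoint fun n => ∀ j, V n j) → ℝ}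
    (hψ : IsInternalSimple e ψ) {X : Set (LoebPoint fun n => ∀ j, V n j)}
    (hX : X ∈ internalBoxes V S) :
    ∃ X', MeasurableSet[loebSigma V S'] X' ∧
      |∫ x in X, ψ x ∂loebMeasure| ≤ |∫ x in X', ψ x ∂loebMeasure| := by
  obtain ⟨Y, hY, rfl⟩ := hX
  choose A hA hAY using hY
  obtain ⟨G, hG, hGlim⟩ := hψ.exists_lift
  have hXA : ⋂ k, Y k = internalSet fun n => ⋂ k, A k n := by
    ext x
    simp only [mem_iInter, ← hAY, mem_internalSet]
    exact eventually_all.symm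
  choose y hy using fun n => exists_abs_sum_le_abs_sum_glue e ((⋂ k, A k n).indicator (G n))
  refine ⟨internalSet fun n => ⋂ k, {x | glue e x (y n) ∈ A k n}, ?_, ?_⟩
  · have : (internalSet fun n => ⋂ k, {x | glue e x (y n) ∈ A k n}) =
        ⋂ k, internalSet fun n => {x | glue e x (y n) ∈ A k n} := by
      ext x
      simp only [mem_iInter, mem_internalSet]
      exact eventually_all
    rw [this]
    refine MeasurableSet.iInter fun k => ?_
    obtain ⟨k', hk', hkk'⟩ := hS k.1 k.2
    exact IsInternal.measurableSet_loebSigma (k := k.1 ∩ e)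
      ⟨_, fun n => isCylinder_preimage_glue (hA k n) (y n), rfl⟩ hk' hkk'
  · rw [hXA]
    refine le_of_tendsto_of_tendsto (hGlim _).abs (hGlim _).abs (Eventually.of_forall fun n => ?_)
    simp only [abs_div]
    refine div_le_div_of_nonneg_right ?_ (abs_nonneg _)
    refine (hy n).trans_eq ?_
    congr 1
    refine Finset.sum_congr rfl fun x _ => ?_
    have hGx : G n (glue e x (y n)) = G n x := hG n _ _ fun j hj => glue_of_mem x (y n) hj
    have hmem : glue e x (y n) ∈ ⋂ k, A k n ↔ x ∈ ⋂ k, {x | glue e x (y n) ∈ A k n} := by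
      simp only [mem_iInter]; rfl
    by_cases hm : glue e x (y n) ∈ ⋂ k, A k n
    · rw [indicator_of_mem hm, indicator_of_mem (hmem.1 hm), hGx]
    · rw [indicator_of_notMem hm, indicator_of_notMem (mt hmem.2 hm)]

/-- Boxes form a π-system generating the σ-algebra. On a box, `g` is replaced by an L¹-close
internal simple function, whose integral is dominated by one over a set of the smaller σ-algebra,
where `g` integrates to zero. -/
theorem setIntegral_eq_zero_of_subfamily {e : Finset J} {S S' : Set (Finset J)}
    (hS : ∀ k ∈ S, ∃ k' ∈ S', k ∩ e ⊆ k')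
    {g : (LoebPoint fun n => ∀ j, V n j) → ℝ} (hg : StronglyMeasurable[loebSigma V {e}] g)
    (hgi : Integrable g loebMeasure)
    (h : ∀ B, MeasurableSet[loebSigma V S'] B → ∫ x in B, g x ∂loebMeasure = 0)
    {X : Set (LoebPoint fun n => ∀ j, V n j)} (hX : MeasurableSet[loebSigma V S] X) :
    ∫ x in X, g x ∂loebMeasure = 0 := by
  have huniv : ∫ x, g x ∂loebMeasure = 0 := by
    rw [← setIntegral_univ]; exact h univ MeasurableSet.univ
  induction X, hX using MeasurableSpace.induction_on_inter
    (loebSigma_eq_generateFrom_internalBoxes S) (isPiSystem_internalBoxes S) with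
  | empty => simp
  | basic X hX =>
    refine abs_nonpos_iff.1 (le_of_forall_pos_le_add fun ε hε => ?_)
    obtain ⟨ψ, hψ, hψg⟩ := exists_isInternalSimple_integral_abs_sub_le hg hgi (half_pos hε)
    obtain ⟨X', hX', hXX'⟩ := hψ.exists_abs_setIntegral_le hS hX
    have hdiff : ∀ Z : Set (LoebPoint fun n => ∀ j, V n j),
        |∫ x in Z, g x ∂loebMeasure - ∫ x in Z, ψ x ∂loebMeasure| ≤ ε / 2 := by
      intro Z
      rw [← integral_sub hgi.integrableOn hψ.integrable.integrableOn]
      refine (abs_integral_le_integral_abs).trans (le_trans ?_ hψg)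
      exact setIntegral_le_integral (hgi.sub hψ.integrable).abs
        (Eventually.of_forall fun x => abs_nonneg _)
    have h1 := hdiff X
    have h2 := hdiff X'
    rw [h X' hX'] at h2
    have h3 := abs_sub_abs_le_abs_sub (∫ x in X, g x ∂loebMeasure) (∫ x in X, ψ x ∂loebMeasure)
    rw [zero_sub, abs_neg] at h2
    linarith
  | compl t ht ih =>
    rw [setIntegral_compl (loebSigma_le S _ ht) hgi, huniv, ih, sub_zero]
  | iUnion f hf hfm ih =>
    rw [integral_iUnion (fun i => loebSigma_le S _ (hfm i)) hf hgi.integrableOn]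
    simp [ih]

theorem setIntegral_condExp_of_subfamily {e : Finset J} {S S' : Set (Finset J)}
    (hS' : ∀ k ∈ S', k ⊆ e) (hS : ∀ k ∈ S, ∃ k' ∈ S', k ∩ e ⊆ k')
    {g : (LoebPoint fun n => ∀ j, V n j) → ℝ} (hg : StronglyMeasurable[loebSigma V {e}] g)
    (hgi : Integrable g loebMeasure)
    {X : Set (LoebPoint fun n => ∀ j, V n j)} (hX : MeasurableSet[loebSigma V S] X) :
    ∫ x in X, (loebMeasure[g | loebSigma V S']) x ∂loebMeasure = ∫ x in X, g x ∂loebMeasure := by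
  have hle : loebSigma V S' ≤ loebSigma V {e} :=
    loebSigma_mono fun k hk => ⟨e, rfl, hS' k hk⟩
  have := setIntegral_eq_zero_of_subfamily hS
    (g := loebMeasure[g | loebSigma V S'] - g) ((stronglyMeasurable_condExp.mono hle).sub hg)
    (integrable_condExp.sub hgi)
    (fun B hB => by
      simp only [Pi.sub_apply]
      rw [integral_sub integrable_condExp.integrableOn hgi.integrableOn,
        setIntegral_condExp (loebSigma_le S') hgi hB, sub_self]) hX
  simp only [Pi.sub_apply] at this
  rw [integral_sub integrable_condExp.integrableOn hgi.integrableOn] at this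
  linarith

/-- Comparison of two sets depending on the coordinates in `e`: a threshold set for their relative
densities can be found in the σ-algebra of lower order, and it controls all sets that are
relatively independent. -/
theorem exists_threshold {e : Finset J} {S S' : Set (Finset J)}
    (hS' : ∀ k ∈ S', k ⊆ e) (hS : ∀ k ∈ S, ∃ k' ∈ S', k ∩ e ⊆ k')
    {A B : Set (LoebPoint fun n => ∀ j, V n j)} (hA : MeasurableSet[loebSigma V {e}] A)
    (hB : MeasurableSet[loebSigma V {e}] B) (a : ℝ) :
    ∃ L, MeasurableSet[loebSigma V S'] L ∧ ∀ X, MeasurableSet[loebSigma V S] X →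
      (X ⊆ L → loebMeasure.real (X ∩ A) ≤ a * loebMeasure.real (X ∩ B)) ∧
      (Disjoint X L → a * loebMeasure.real (X ∩ B) ≤ loebMeasure.real (X ∩ A)) := by
  have hA' := loebSigma_le _ _ hA
  have hB' := loebSigma_le _ _ hB
  set g : (LoebPoint fun n => ∀ j, V n j) → ℝ :=
    (B.indicator fun _ => a) - A.indicator fun _ => 1 with hg
  have hgm : StronglyMeasurable[loebSigma V {e}] g :=
    (stronglyMeasurable_const.indicator hB).sub (stronglyMeasurable_const.indicator hA)
  have hgB : Integrable (B.indicator fun _ => a) (loebMeasure (W := fun n => ∀ j, V n j)) :=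
    (integrable_const a).indicator hB'
  have hgA : Integrable (A.indicator fun _ => (1 : ℝ))
      (loebMeasure (W := fun n => ∀ j, V n j)) := (integrable_const 1).indicator hA'
  have hgi : Integrable g loebMeasure := hgB.sub hgA
  have hint : ∀ X : Set (LoebPoint fun n => ∀ j, V n j), ∫ x in X, g x ∂loebMeasure =
      a * loebMeasure.real (X ∩ B) - loebMeasure.real (X ∩ A) := by
    intro X
    simp only [hg, Pi.sub_apply]
    rw [integral_sub hgB.integrableOn hgA.integrableOn, setIntegral_indicator hB',
      setIntegral_indicator hA', setIntegral_const, setIntegral_const]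
    simp [mul_comm]
  -- The sign of the conditional expectation of `a * 1_B - 1_A` decides the comparison, since on the
  -- sets `X` it has the same integrals as that function.
  set L : Set (LoebPoint fun n => ∀ j, V n j) := {x | 0 ≤ (loebMeasure[g | loebSigma V S']) x}
    with hL
  have hLm : MeasurableSet[loebSigma V S'] L :=
    measurableSet_le (@measurable_const _ _ _ (loebSigma V S') _)
      stronglyMeasurable_condExp.measurable
  refine ⟨L, hLm, fun X hX => ?_⟩
  have key := setIntegral_condExp_of_subfamily hS' hS hgm hgi hX
  rw [hint] at key
  have hXm := loebSigma_le _ _ hX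
  constructor
  · intro hXL
    have : 0 ≤ ∫ x in X, (loebMeasure[g | loebSigma V S']) x ∂loebMeasure :=
      setIntegral_nonneg hXm fun x hx => hXL hx
    linarith
  · intro hXL
    have : ∫ x in X, (loebMeasure[g | loebSigma V S']) x ∂loebMeasure ≤ 0 :=
      setIntegral_nonpos hXm fun x hx =>
        (not_le.1 fun h => disjoint_left.1 hXL hx h).le
    linarith

end Independence

/-! ### Approximation by internal colorings -/

section Coloring

variable {J : Type} {V : ℕ → J → Type*}

/-- The sets determined by finitely many colors, where for each `k ∈ S` there is a coloring with
internal color classes depending only on the coordinates in `k`. -/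
def colorAlgebra (V : ℕ → J → Type*) (S : Set (Finset J)) :
    Set (Set (LoebPoint fun n => ∀ j, V n j)) :=
  {G | ∃ (T : Type) (_ : Finite T) (c : Finset J → (LoebPoint fun n => ∀ j, V n j) → T),
    (∀ k t, IsInternal k {x | c k x = t}) ∧
      ∀ x y, (∀ k ∈ S, c k x = c k y) → x ∈ G → y ∈ G}

theorem isInternal_const {P : Prop} (e : Finset J) :
    IsInternal e {_x : LoebPoint fun n => ∀ j, V n j | P} := by
  by_cases h : P
  · simpa [h] using! isInternal_univ e
  · simpa [h] using! isInternal_empty e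

theorem isSetAlgebra_colorAlgebra (S : Set (Finset J)) : IsSetAlgebra (colorAlgebra V S) where
  empty_mem := ⟨Unit, inferInstance, fun _ _ => (), fun _ _ => isInternal_const _,
    fun _ _ _ h => h⟩
  compl_mem := by
    rintro G ⟨T, hT, c, hc, hG⟩
    exact ⟨T, hT, c, hc, fun x y hxy hx hy => hx (hG y x (fun k hk => (hxy k hk).symm) hy)⟩
  union_mem := by
    rintro G G' ⟨T, hT, c, hc, hG⟩ ⟨T', hT', c', hc', hG'⟩
    refine ⟨T × T', inferInstance, fun k x => (c k x, c' k x), fun k t => ?_, fun x y hxy hx => ?_⟩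
    · convert (hc k t.1).inter (hc' k t.2) using 1
      ext x
      exact Prod.ext_iff
    · exact hx.imp (hG x y fun k hk => (Prod.ext_iff.1 (hxy k hk)).1)
        (hG' x y fun k hk => (Prod.ext_iff.1 (hxy k hk)).2)

variable [Finite J]

theorem measurableSet_of_mem_colorAlgebra {S : Set (Finset J)}
    {G : Set (LoebPoint fun n => ∀ j, V n j)} (hG : G ∈ colorAlgebra V S) :
    MeasurableSet[loebSigma V S] G := by
  obtain ⟨T, hT, c, hc, hG⟩ := hG
  have : G = ⋃ t : {t : S → T // ∃ x ∈ G, ∀ k : S, c k x = t k}, ⋂ k : S, {x | c k x = t.1 k} := by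
    ext x
    simp only [mem_iUnion, mem_iInter]
    constructor
    · exact fun hx => ⟨⟨fun k => c k x, x, hx, fun _ => rfl⟩, fun k => rfl⟩
    · rintro ⟨⟨t, y, hy, hyt⟩, hxt⟩
      exact hG y x (fun k hk => (hyt ⟨k, hk⟩).trans (hxt ⟨k, hk⟩).symm) hy
  rw [this]
  exact MeasurableSet.iUnion fun t => MeasurableSet.iInter fun k =>
    (hc k _).measurableSet_loebSigma k.2 subset_rfl

theorem loebSigma_eq_generateFrom_colorAlgebra (S : Set (Finset J)) :
    loebSigma V S = MeasurableSpace.generateFrom (colorAlgebra V S) := by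
  classical
  refine le_antisymm (MeasurableSpace.generateFrom_le ?_)
    (MeasurableSpace.generateFrom_le fun G hG => measurableSet_of_mem_colorAlgebra hG)
  rintro X ⟨k, hk, hX⟩
  -- The palette is `Prop`: membership in `X` is the color at `k`, and every other index set is
  -- colored constantly.
  refine MeasurableSpace.measurableSet_generateFrom
    ⟨Prop, inferInstance, fun k' x => k' = k ∧ x ∈ X, fun k' t => ?_, fun x y hxy hx => ?_⟩
  · by_cases h : k' = k
    · subst h
      by_cases ht : t
      · simpa [ht] using! hX
      · simpa [ht] using! hX.compl
    · simp only [h, false_and]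
      exact isInternal_const _
  · have := hxy k hk
    simp only [true_and, eq_iff_iff] at this
    exact this.1 hx

variable [∀ n j, Fintype (V n j)] [∀ n j, Nonempty (V n j)]

theorem exists_coloring_approx [Fintype J] [DecidableEq J] {ι : Type} [Finite ι] {S : ι → Set (Finset J)}
    {F : ι → Set (LoebPoint fun n => ∀ j, V n j)}
    (hF : ∀ i, MeasurableSet[loebSigma V (S i)] (F i)) {ε : ℝ} (hε : 0 < ε) :
    ∃ (T : Type) (_ : Finite T) (c : Finset J → (LoebPoint fun n => ∀ j, V n j) → T)
      (G : ι → Set (LoebPoint fun n => ∀ j, V n j)),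
      (∀ k t, IsInternal k {x | c k x = t}) ∧
      ∀ i, (∀ x y, (∀ k ∈ S i, c k x = c k y) → x ∈ G i → y ∈ G i) ∧ MeasurableSet (G i) ∧
        loebMeasure.real (F i \ G i) ≤ ε ∧ loebMeasure.real (G i \ F i) ≤ ε := by
  have key : ∀ i, ∃ G ∈ colorAlgebra V (S i), loebMeasure (symmDiff (F i) G) < ENNReal.ofReal ε := by
    intro i
    have hle : loebSigma V (S i) ≤ _ := loebSigma_le (S i)
    obtain ⟨G, hG, hGε⟩ := exists_measure_symmDiff_lt_of_isSetAlgebra (loebMeasure.trim hle)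
      (isSetAlgebra_colorAlgebra (S i)) (loebSigma_eq_generateFrom_colorAlgebra (S i)) (hF i) hε
    rw [trim_measurableSet_eq hle
      ((hF i).symmDiff (measurableSet_of_mem_colorAlgebra hG))] at hGε
    exact ⟨G, hG, hGε⟩
  choose G hG hGε using key
  have hGm := fun i => loebSigma_le _ _ (measurableSet_of_mem_colorAlgebra (hG i))
  choose T hT c hc hsat using hG
  have hreal : ∀ i, loebMeasure.real (symmDiff (F i) (G i)) ≤ ε := fun i =>
    ENNReal.toReal_le_of_le_ofReal hε.le (hGε i).le
  -- The product of the palettes gives one coloring that refines all of them.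
  refine ⟨∀ i, T i, inferInstance, fun k x i => c i k x, G, fun k t => ?_, fun i =>
    ⟨fun x y hxy => hsat i x y fun k hk => congrFun (hxy k hk) i, hGm i, ?_, ?_⟩⟩
  · convert IsInternal.iInter fun i => hc i k (t i) using 1
    ext x
    simp only [mem_iInter]
    exact funext_iff
  · exact (measureReal_mono subset_union_left).trans (hreal i)
  · exact (measureReal_mono subset_union_right).trans (hreal i)

end Coloring

/-! ### Density thresholds one order lower -/

section Levels

variable {J : Type} {V : ℕ → J → Type*}

theorem loebSigma_level_le (r : ℕ) (e : Finset J) :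
    loebSigma V {k | k ⊆ e ∧ k.card + 1 = r} ≤ loebSigma V {k | k.card < r} :=
  loebSigma_mono fun k hk => ⟨k, (Nat.lt_succ_self _).trans_eq hk.2, subset_rfl⟩

theorem loebSigma_level_le_singleton (r : ℕ) (e : Finset J) :
    loebSigma V {k | k ⊆ e ∧ k.card + 1 = r} ≤ loebSigma V {e} :=
  loebSigma_mono fun _ hk => ⟨e, rfl, hk.1⟩

variable [DecidableEq J]

theorem IsInternal.measurableSet_loebSigma_inter_card_lt {r : ℕ} {k e : Finset J}
    {X : Set (LoebPoint fun n => ∀ j, V n j)} (h : IsInternal k X) (hk : (k ∩ e).card < r) :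
    MeasurableSet[loebSigma V {k | (k ∩ e).card < r}] X :=
  h.measurableSet_loebSigma hk subset_rfl

theorem card_inter_lt_of_not_subset {k e : Finset J} (h : ¬ k ⊆ e) : (k ∩ e).card < k.card :=
  Finset.card_lt_card (Finset.inter_subset_left.ssubset_of_not_subset
    fun h' => h (h'.trans Finset.inter_subset_right))

theorem loebSigma_card_lt_le (r : ℕ) (e : Finset J) :
    loebSigma V {k | k.card < r} ≤ loebSigma V {k | (k ∩ e).card < r} :=
  loebSigma_mono fun k hk =>
    ⟨k, (Finset.card_le_card Finset.inter_subset_left).trans_lt hk, subset_rfl⟩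

variable [Fintype J] [∀ n j, Fintype (V n j)] [∀ n j, Nonempty (V n j)]

theorem exists_threshold_level {r : ℕ} {e : Finset J} (hr : r ≤ e.card)
    {A B : Set (LoebPoint fun n => ∀ j, V n j)} (hA : MeasurableSet[loebSigma V {e}] A)
    (hB : MeasurableSet[loebSigma V {e}] B) (a : ℝ) :
    ∃ L, MeasurableSet[loebSigma V {k | k ⊆ e ∧ k.card + 1 = r}] L ∧
      (∀ X, MeasurableSet[loebSigma V {k | (k ∩ e).card < r}] X → X ⊆ L →
        loebMeasure.real (X ∩ A) ≤ a * loebMeasure.real (X ∩ B)) ∧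
      a * loebMeasure.real (B \ L) ≤ loebMeasure.real (A \ L) := by
  obtain ⟨L, hL, h⟩ := exists_threshold (S := {k | (k ∩ e).card < r})
    (S' := {k | k ⊆ e ∧ k.card + 1 = r}) (fun k hk => hk.1) (fun k hk => by
      -- Since `r ≤ e.card`, the set `k ∩ e` can be padded inside `e` to exactly `r - 1` elements.
      have hk' : (k ∩ e).card < r := hk
      obtain ⟨k', h1, h2, h3⟩ := Finset.exists_subsuperset_card_eq
        (Finset.inter_subset_right : k ∩ e ⊆ e) (by omega : (k ∩ e).card ≤ r - 1) (by omega)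
      exact ⟨k', ⟨h2, by omega⟩, h1⟩) hA hB a
  refine ⟨L, hL, fun X hX => (h X hX).1, ?_⟩
  have hL' := loebSigma_card_lt_le r e _ (loebSigma_level_le r e _ hL)
  have := (h Lᶜ hL'.compl).2 disjoint_compl_left
  rwa [inter_comm, inter_comm _ A, ← sdiff_eq, ← sdiff_eq] at this

/-- The classes are inserted one at a time. Distinct `r`-sets meet in fewer than `r` elements, so
the intersection built so far is an admissible test set for the threshold of the next class, and its
measure drops by at most a factor `a`. -/
theorem measureReal_inter_pos_of_thresholds {r : ℕ} {a : ℝ} {K : Finset (Finset J)}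
    (hK : ∀ k ∈ K, k.card = r) {Q : Finset J → Set (LoebPoint fun n => ∀ j, V n j)}
    (hQ : ∀ k ∈ K, IsInternal k (Q k)) {Y : Set (LoebPoint fun n => ∀ j, V n j)}
    (hY : MeasurableSet[loebSigma V {k | k.card < r}] Y) (hpos : 0 < loebMeasure.real Y)
    (h : ∀ k ∈ K, ∀ X, MeasurableSet[loebSigma V {k' | (k' ∩ k).card < r}] X → X ⊆ Y →
      loebMeasure.real X ≤ a * loebMeasure.real (X ∩ Q k)) :
    0 < loebMeasure.real (Y ∩ ⋂ k ∈ K, Q k) := by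
  induction K using Finset.induction_on with
  | empty => simpa using hpos
  | insert k K hkK ih =>
    have ih := ih (fun k' hk' => hK k' (Finset.mem_insert_of_mem hk'))
      (fun k' hk' => hQ k' (Finset.mem_insert_of_mem hk'))
      (fun k' hk' => h k' (Finset.mem_insert_of_mem hk'))
    have hm : MeasurableSet[loebSigma V {k' | (k' ∩ k).card < r}] (Y ∩ ⋂ k ∈ K, Q k) := by
      refine (loebSigma_card_lt_le r k _ hY).inter (Finset.measurableSet_biInter K fun k' hk' => ?_)
      have hk'r := hK k' (Finset.mem_insert_of_mem hk')
      refine (hQ k' (Finset.mem_insert_of_mem hk')).measurableSet_loebSigma_inter_card_lt ?_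
      rw [← hk'r]
      refine card_inter_lt_of_not_subset fun hsub => hkK ?_
      rwa [← Finset.eq_of_subset_of_card_le hsub
        (by rw [hK k (Finset.mem_insert_self _ _), hk'r])]
    have := h k (Finset.mem_insert_self _ _) _ hm inter_subset_left
    rw [Finset.set_biInter_insert, inter_comm (Q k), ← inter_assoc]
    by_contra hneg
    have hzero : loebMeasure.real ((Y ∩ ⋂ k ∈ K, Q k) ∩ Q k) = 0 :=
      le_antisymm (not_lt.1 hneg) measureReal_nonneg
    rw [hzero, mul_zero] at this
    linarith

end Levels

/-! ### Removal on the Loeb space -/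

section LoebRemoval

variable {J : Type} {V : ℕ → J → Type*} [Fintype J] [DecidableEq J]
  [∀ n j, Fintype (V n j)] [∀ n j, Nonempty (V n j)]

/-- Every family of sets measurable at level `r` can be shrunk, up to small error, to internal sets
which have no common point unless the original sets have an intersection of positive measure. -/
theorem exists_internal_removal (r : ℕ) : ∀ {ι : Type} [Finite ι] (e : ι → Finset J)
    (F : ι → Set (LoebPoint fun n => ∀ j, V n j)), (∀ i, r ≤ (e i).card + 1) →
    (∀ i, MeasurableSet[loebSigma V {k | k ⊆ e i ∧ k.card + 1 = r}] (F i)) →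
    ∀ {γ : ℝ}, 0 < γ → ∃ G : ι → Set (LoebPoint fun n => ∀ j, V n j),
      (∀ i, IsInternal (e i) (G i)) ∧ (∀ i, loebMeasure.real (F i \ G i) ≤ γ) ∧
      ∀ I : Set ι, (⋂ i ∈ I, G i).Nonempty → 0 < loebMeasure.real (⋂ i ∈ I, F i) := by
  classical
  induction r with
  | zero =>
    intro ι _ e F _ hF γ hγ
    have hF' : ∀ i, F i = ∅ ∨ F i = univ := by
      intro i
      have h := hF i
      -- Level `r` concerns sets of `r - 1` coordinates; with this offset the base level has no
      -- generators.
      have : loebSigma V {k | k ⊆ e i ∧ k.card + 1 = 0} = ⊥ := by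
        simp [loebSigma]
      rwa [this, MeasurableSpace.measurableSet_bot_iff] at h
    refine ⟨F, fun i => ?_, fun i => by simpa using hγ.le, fun I hI => ?_⟩
    · rcases hF' i with h | h <;> rw [h]
      exacts [isInternal_empty _, isInternal_univ _]
    · have : ⋂ i ∈ I, F i = univ := by
        obtain ⟨x, hx⟩ := hI
        refine eq_univ_of_forall fun y => mem_iInter₂.2 fun i hi => ?_
        rw [(hF' i).resolve_left fun h => ?_]
        · trivial
        have := mem_iInter₂.1 hx i hi
        rwa [h] at this
      rw [this]
      simp
  | succ r ih =>
    intro ι _ e F hr hF γ hγ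
    have _ := Fintype.ofFinite ι
    have hre : ∀ i, r ≤ (e i).card := fun i => by have := hr i; omega
    have hFe : ∀ i, MeasurableSet[loebSigma V {e i}] (F i) := fun i =>
      loebSigma_level_le_singleton _ _ _ (hF i)
    have hFm : ∀ i, MeasurableSet (F i) := fun i => loebSigma_le _ _ (hF i)
    -- `κ` is the defect allowed to each set within a cell; all the defects together stay below the
    -- measure of the cell.
    obtain ⟨κ, hκ, hκι⟩ : ∃ κ : ℝ, 0 < κ ∧ Fintype.card ι * κ < 1 :=
      ⟨1 / (Fintype.card ι + 1), by positivity, by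
        rw [mul_one_div, div_lt_one (by positivity)]; linarith⟩
    -- `γ₁` pays for the approximation by cells and `γ₁ / κ` for the cells of low density.
    obtain ⟨γ₁, hγ₁, hγ₁'⟩ : ∃ γ₁ : ℝ, 0 < γ₁ ∧ γ₁ + γ₁ / κ = γ / 2 := by
      refine ⟨γ / 2 / (1 + 1 / κ), by positivity, ?_⟩
      field_simp
    obtain ⟨T, _, c, G₀, hc, hG₀⟩ := exists_coloring_approx hF hγ₁
    have _ := Fintype.ofFinite T
    let col : ∀ i, (LoebPoint fun n => ∀ j, V n j) → ({k // k ⊆ e i ∧ k.card = r} → T) :=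
      fun i x k => c k x
    let C : ∀ i, ({k // k ⊆ e i ∧ k.card = r} → T) → Set (LoebPoint fun n => ∀ j, V n j) :=
      fun i t => {x | col i x = t}
    have hC : ∀ i t, IsInternal (e i) (C i t) := by
      intro i t
      convert IsInternal.iInter (ι := {k // k ⊆ e i ∧ k.card = r})
        fun k => (hc k (t k)).mono k.2.1 using 1
      ext x
      simp only [mem_iInter]
      exact funext_iff
    have hCe : ∀ i t, MeasurableSet[loebSigma V {e i}] (C i t) := fun i t =>
      (hC i t).measurableSet_loebSigma rfl subset_rfl
    have hcol : ∀ i x, x ∈ G₀ i → C i (col i x) ⊆ G₀ i := fun i x hx y hy =>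
      (hG₀ i).1 x y (fun k hk => (congrFun hy ⟨k, hk.1, by have := hk.2; omega⟩).symm) hx
    -- thresholds for the relative density of `F i` in the cells
    choose L hL hLdens hLsmall using fun i t =>
      exists_threshold_level (hre i) ((hCe i t).diff (hFe i)) (hCe i t) κ
    -- thresholds for the density of the color classes
    let Λ := (Σ i, ({k // k ⊆ e i ∧ k.card = r} → T)) ⊕ ({k : Finset J // k.card = r} × T)
    -- `η` is both the least density allowed to a color and the error allowed to each internal
    -- replacement of a threshold set; each use costs at most `γ / 4`.
    obtain ⟨η, hη, hη'⟩ : ∃ η : ℝ, 0 < η ∧ Fintype.card Λ * η ≤ γ / 4 := by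
      refine ⟨γ / 4 / (Fintype.card Λ + 1), by positivity, ?_⟩
      rw [mul_div_assoc', div_le_iff₀ (by positivity)]
      nlinarith
    choose N hN hNdens hNsmall using fun (k : {k : Finset J // k.card = r}) (q : T) =>
      exists_threshold_level (r := r) (e := k.1) k.2.ge (A := univ) MeasurableSet.univ
        ((hc k q).measurableSet_loebSigma rfl subset_rfl) η⁻¹
    obtain ⟨M, hM, hMsmall, hMpos⟩ := ih (ι := Λ)
      (Sum.elim (fun p => e p.1) fun p => p.1.1)
      (Sum.elim (fun p => L p.1 p.2) fun p => N p.1 p.2)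
      (by
        rintro (⟨i, t⟩ | ⟨k, q⟩)
        · exact (hre i).trans (Nat.le_succ _)
        · exact k.2.ge.trans (Nat.le_succ _))
      (by
        rintro (⟨i, t⟩ | ⟨k, q⟩)
        exacts [hL i t, hN k q]) hη
    -- The cells inside `G₀ i` are kept, cut down by the internal replacements of the threshold sets
    -- of the cell and of each of its colors.
    let G : ι → Set (LoebPoint fun n => ∀ j, V n j) := fun i =>
      ⋃ t : {t // C i t ⊆ G₀ i}, C i t ∩ M (Sum.inl ⟨i, t⟩) ∩
        ⋂ k : {k // k ⊆ e i ∧ k.card = r}, M (Sum.inr (⟨k, k.2.2⟩, t.1 k))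
    refine ⟨G, fun i => ?_, fun i => ?_, fun I hI => ?_⟩
    · exact IsInternal.iUnion fun t => ((hC i t).inter (hM (Sum.inl ⟨i, t⟩))).inter
        (IsInternal.iInter fun k => (hM (Sum.inr (⟨k, k.2.2⟩, t.1 k))).mono k.2.1)
    · have hcover : F i \ G i ⊆ (F i \ G₀ i) ∪
          ((⋃ t ∈ Finset.univ.filter fun t => C i t ⊆ G₀ i, C i t \ L i t) ∪
          ((⋃ z : Λ, (Sum.elim (fun p => L p.1 p.2) fun p => N p.1 p.2 : Λ → Set _) z \ M z) ∪
          ⋃ p : {k : Finset J // k.card = r} × T, {x | c p.1 x = p.2} \ N p.1 p.2)) := by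
        rintro x ⟨hxF, hxG⟩
        by_contra hx
        simp only [mem_union, not_or, mem_iUnion, not_exists, Set.mem_sdiff, not_and, not_not] at hx
        obtain ⟨h1, h2, h3, h4⟩ := hx
        have hxG₀ := h1 hxF
        refine hxG (mem_iUnion.2 ⟨⟨col i x, hcol i x hxG₀⟩, ⟨rfl, ?_⟩, mem_iInter.2 fun k => ?_⟩)
        · exact h3 (Sum.inl ⟨i, col i x⟩) (h2 (col i x) (by simpa using hcol i x hxG₀) rfl)
        · exact h3 (Sum.inr (⟨k, k.2.2⟩, c k x)) (h4 (⟨k, k.2.2⟩, c k x) rfl)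
      have hB : loebMeasure.real (⋃ t ∈ Finset.univ.filter fun t => C i t ⊆ G₀ i, C i t \ L i t)
          ≤ γ₁ / κ := by
        rw [le_div_iff₀' hκ]
        calc κ * loebMeasure.real
              (⋃ t ∈ Finset.univ.filter fun t => C i t ⊆ G₀ i, C i t \ L i t)
            ≤ κ * ∑ t ∈ Finset.univ.filter fun t => C i t ⊆ G₀ i,
                loebMeasure.real (C i t \ L i t) := by
              gcongr; exact measureReal_biUnion_finset_le _ _
          -- Off its threshold set a cell has defect at least `κ` times its measure, and the
          -- disjoint defects add up to at most the measure of `G₀ i \ F i`.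
          _ ≤ ∑ t ∈ Finset.univ.filter fun t => C i t ⊆ G₀ i,
                loebMeasure.real (C i t \ F i) := by
              rw [Finset.mul_sum]
              exact Finset.sum_le_sum fun t _ =>
                (hLsmall i t).trans (measureReal_mono sdiff_subset)
          _ = loebMeasure.real
                (⋃ t ∈ Finset.univ.filter fun t => C i t ⊆ G₀ i, C i t \ F i) := by
              refine (measureReal_biUnion_finset (fun t _ t' _ htt' => ?_)
                fun t _ => (hC i t).measurableSet.diff (hFm i)).symm
              refine disjoint_left.2 fun x hx hx' => htt' ?_
              exact (show col i x = t from hx.1).symm.trans hx'.1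
          _ ≤ loebMeasure.real (G₀ i \ F i) := by
              refine measureReal_mono (iUnion₂_subset fun t ht => ?_)
              exact sdiff_subset_sdiff_left (by simpa using ht)
          _ ≤ γ₁ := (hG₀ i).2.2.2
      have hD : loebMeasure.real (⋃ z : Λ,
          (Sum.elim (fun p => L p.1 p.2) fun p => N p.1 p.2 : Λ → Set _) z \ M z)
          ≤ Fintype.card Λ * η := by
        refine (measureReal_iUnion_fintype_le _).trans ?_
        refine (Finset.sum_le_sum fun z _ => hMsmall z).trans_eq ?_
        simp
      have hE : loebMeasure.real (⋃ p : {k : Finset J // k.card = r} × T,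
          {x | c p.1 x = p.2} \ N p.1 p.2) ≤ Fintype.card Λ * η := by
        refine (measureReal_iUnion_fintype_le _).trans ?_
        refine (Finset.sum_le_sum (g := fun _ => η) fun p _ => ?_).trans ?_
        -- Off its threshold set a color class has at most `η` times the measure of the whole space.
        · have := (hNsmall p.1 p.2).trans measureReal_le_one
          rwa [inv_mul_le_iff₀ hη, mul_one] at this
        · simp only [Finset.sum_const, nsmul_eq_mul, Finset.card_univ]
          gcongr
          exact Fintype.card_le_of_injective (Sum.inr : _ → Λ) Sum.inr_injective
      refine (measureReal_mono hcover).trans ((measureReal_union_le _ _).trans ?_)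
      refine (add_le_add (hG₀ i).2.2.1 ((measureReal_union_le _ _).trans (add_le_add hB
        ((measureReal_union_le _ _).trans (add_le_add hD hE))))).trans ?_
      linarith
    · obtain ⟨x, hx⟩ := hI
      have hxG : ∀ i ∈ I, x ∈ M (Sum.inl ⟨i, col i x⟩) ∧
          ∀ k (hk : k ⊆ e i ∧ k.card = r), x ∈ M (Sum.inr (⟨k, hk.2⟩, c k x)) := by
        intro i hi
        obtain ⟨⟨t, ht⟩, ⟨hxC, hxM⟩, hxk⟩ := mem_iUnion.1 (mem_iInter₂.1 hx i hi)
        obtain rfl : col i x = t := hxC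
        exact ⟨hxM, fun k hk => mem_iInter.1 hxk ⟨k, hk⟩⟩
      let K : Finset (Finset J) := Finset.univ.filter fun k => k.card = r ∧ ∃ i ∈ I, k ⊆ e i
      have hKr : ∀ k ∈ K, k.card = r := fun k hk => (Finset.mem_filter.1 hk).2.1
      -- These are the threshold sets belonging to the cells and colors of the point `x`. Their
      -- replacements meet at `x`, so the induction hypothesis gives `Y` positive measure.
      let I' : Set Λ := {z | Sum.elim (fun p => p.1 ∈ I ∧ p.2 = col p.1 x)
        (fun p => p.1.1 ∈ K ∧ p.2 = c p.1 x) z}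
      let Y : Set (LoebPoint fun n => ∀ j, V n j) :=
        ⋂ z ∈ I', (Sum.elim (fun p => L p.1 p.2) fun p => N p.1 p.2 : Λ → Set _) z
      have hYpos : 0 < loebMeasure.real Y := by
        refine hMpos I' ⟨x, mem_iInter₂.2 ?_⟩
        rintro (⟨i, t⟩ | ⟨k, q⟩) hz
        · obtain ⟨hi, rfl⟩ : i ∈ I ∧ t = col i x := hz
          exact (hxG i hi).1
        · obtain ⟨hk, rfl⟩ : k.1 ∈ K ∧ q = c k x := hz
          obtain ⟨-, -, i, hi, hki⟩ := Finset.mem_filter.1 hk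
          exact (hxG i hi).2 k ⟨hki, k.2⟩
      have hYL : ∀ i ∈ I, Y ⊆ L i (col i x) := fun i hi =>
        biInter_subset_of_mem (x := (Sum.inl ⟨i, col i x⟩ : Λ)) (show _ ∧ _ from ⟨hi, rfl⟩)
      have hYN : ∀ k (hk : k ∈ K), Y ⊆ N ⟨k, hKr k hk⟩ (c k x) := fun k hk =>
        biInter_subset_of_mem (x := (Sum.inr (⟨k, hKr k hk⟩, c k x) : Λ))
          (show _ ∧ _ from ⟨hk, rfl⟩)
      have hYm : MeasurableSet[loebSigma V {k | k.card < r}] Y := by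
        refine MeasurableSet.biInter (to_countable _) ?_
        rintro (⟨i, t⟩ | ⟨k, q⟩) -
        exacts [loebSigma_level_le _ _ _ (hL i t), loebSigma_level_le _ _ _ (hN k q)]
      let Q : Finset J → Set (LoebPoint fun n => ∀ j, V n j) := fun k => {y | c k y = c k x}
      let X := Y ∩ ⋂ k ∈ K, Q k
      have hXpos : 0 < loebMeasure.real X :=
        measureReal_inter_pos_of_thresholds (a := η⁻¹) hKr (fun k _ => hc k _) hYm hYpos
          fun k hk Z hZ hZY => by
            simpa using hNdens ⟨k, hKr k hk⟩ (c k x) Z hZ (hZY.trans (hYN k hk))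
      have hXF : ∀ i ∈ I, loebMeasure.real (X \ F i) ≤ κ * loebMeasure.real X := by
        intro i hi
        -- The classes of index sets inside `e i` make up the cell `C i (col i x)`; the others meet
        -- `e i` in fewer than `r` elements, so `Z` is a valid test set for the cell's threshold.
        let Z := Y ∩ ⋂ k ∈ K.filter fun k => ¬ k ⊆ e i, Q k
        have hZm : MeasurableSet[loebSigma V {k | (k ∩ e i).card < r}] Z := by
          refine (loebSigma_card_lt_le r _ _ hYm).inter
            (Finset.measurableSet_biInter _ fun k hk => ?_)
          obtain ⟨hkK, hki⟩ := Finset.mem_filter.1 hk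
          exact (hc k _).measurableSet_loebSigma_inter_card_lt
            ((card_inter_lt_of_not_subset hki).trans_eq (hKr k hkK))
        have hXZ : X = Z ∩ C i (col i x) := by
          ext y
          simp only [X, Z, C, Q, mem_inter_iff, mem_iInter, mem_ofPred_eq, Finset.mem_filter]
          refine ⟨fun h => ⟨⟨h.1, fun k hk => h.2 k hk.1⟩, funext fun k => ?_⟩,
            fun h => ⟨h.1.1, fun k hk => ?_⟩⟩
          · exact h.2 k (Finset.mem_filter.2 ⟨Finset.mem_univ _, k.2.2, i, hi, k.2.1⟩)
          · by_cases hki : k ⊆ e i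
            · exact congrFun h.2 ⟨k, hki, hKr k hk⟩
            · exact h.1.2 k ⟨hk, hki⟩
        have := hLdens i (col i x) Z hZm (inter_subset_left.trans (hYL i hi))
        rwa [← hXZ, ← inter_sdiff_assoc, ← hXZ] at this
      by_contra hneg
      have hzero : loebMeasure.real (⋂ i ∈ I, F i) = 0 :=
        le_antisymm (not_lt.1 hneg) measureReal_nonneg
      have hXcover : X ⊆ (⋂ i ∈ I, F i) ∪ ⋃ i ∈ Finset.univ.filter fun i => i ∈ I, X \ F i := by
        intro y hy
        by_contra h
        simp only [mem_union, not_or, mem_iUnion, not_exists, Set.mem_sdiff, not_and, not_not,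
          Finset.mem_filter, Finset.mem_univ, true_and, mem_iInter, not_forall] at h
        obtain ⟨⟨i, hi, hyi⟩, h2⟩ := h
        exact hyi (h2 i hi hy)
      have hXle : loebMeasure.real X ≤ Fintype.card ι * κ * loebMeasure.real X := by
        calc loebMeasure.real X ≤ loebMeasure.real (⋂ i ∈ I, F i) +
              ∑ i ∈ Finset.univ.filter fun i => i ∈ I, loebMeasure.real (X \ F i) :=
              (measureReal_mono hXcover).trans ((measureReal_union_le _ _).trans
                (add_le_add le_rfl (measureReal_biUnion_finset_le _ _)))
          _ ≤ ∑ i ∈ Finset.univ.filter fun i => i ∈ I, κ * loebMeasure.real X := by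
              rw [hzero, zero_add]
              exact Finset.sum_le_sum fun i hi => hXF i (Finset.mem_filter.1 hi).2
          _ ≤ ∑ _i : ι, κ * loebMeasure.real X :=
              Finset.sum_le_sum_of_subset_of_nonneg (Finset.filter_subset _ _)
                fun _ _ _ => by positivity
          _ = Fintype.card ι * κ * loebMeasure.real X := by simp [mul_assoc]
      -- If the `F i` met in measure zero, their defects would cover almost all of `X`, against
      -- `Fintype.card ι * κ < 1`.
      nlinarith

end LoebRemoval

/-! ### Removal on finite product sets -/

universe u v

theorem exists_cylinder_removal {J : Type} [Fintype J] [DecidableEq J] {H : Finset (Finset J)}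
    {d : ℕ} (hH : ∀ e ∈ H, e.card = d) {ε : ℝ} (hε : 0 < ε) :
    ∃ δ : ℝ, 0 < δ ∧ ∀ (V : J → Type v) [∀ j, Fintype (V j)] [∀ j, Nonempty (V j)]
      (E : Finset J → Set (∀ j, V j)), (∀ e ∈ H, IsCylinder e (E e)) →
      ((⋂ e ∈ H, E e).ncard : ℝ) ≤ δ * Fintype.card (∀ j, V j) →
      ∃ E' : Finset J → Set (∀ j, V j), (∀ e ∈ H, IsCylinder e (E' e)) ∧ ⋂ e ∈ H, E' e = ∅ ∧
        ∀ e ∈ H, ((E e \ E' e).ncard : ℝ) ≤ ε * Fintype.card (∀ j, V j) := by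
  by_contra! hcon
  choose V hVf hVn E hE hcount hbad using fun n : ℕ => hcon (1 / ((n : ℝ) + 1)) (by positivity)
  let F : {e // e ∈ H} → Set (LoebPoint fun n => ∀ j, V n j) := fun e =>
    internalSet fun n => E n e.1
  have hF : ∀ e, IsInternal e.1 (F e) := fun e => ⟨_, fun n => hE n e.1 e.2, rfl⟩
  -- Level `d + 1` admits `e` itself as a generator index. Loss `ε / 2` in the limit leaves room for
  -- loss below `ε` at some finite stage.
  obtain ⟨G, hG, hFG, hpos⟩ := exists_internal_removal (d + 1) (fun e : {e // e ∈ H} => e.1) F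
    (fun e => (Nat.le_of_eq (congrArg (· + 1) (hH e.1 e.2)).symm))
    (fun e => (hF e).measurableSet_loebSigma (k' := e.1)
      ⟨subset_rfl, congrArg (· + 1) (hH e.1 e.2)⟩ subset_rfl) (half_pos hε)
  have hFinter : ⋂ e, F e = internalSet fun n => ⋂ e ∈ H, E n e := by
    rw [← internalSet_biInter]
    exact iInter_subtype _ _
  have hzero : loebMeasure.real (⋂ e, F e) = 0 := by
    refine le_antisymm ?_ measureReal_nonneg
    rw [hFinter]
    refine le_of_tendsto_of_tendsto (tendsto_density _)
      ((tendsto_one_div_add_atTop_nhds_zero_nat (𝕜 := ℝ)).mono_left Nat.hyperfilter_le_atTop)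
      (Eventually.of_forall fun n => ?_)
    rw [div_le_iff₀ (by exact_mod_cast Fintype.card_pos)]
    exact hcount n
  choose A hA hAG using hG
  have hGempty : internalSet (fun n => ⋂ e, A e n) = ∅ := by
    by_contra hne
    obtain ⟨x, hx⟩ := nonempty_iff_ne_empty.2 hne
    have := hpos univ ⟨x, by
      simp only [mem_univ, iInter_true, mem_iInter, ← hAG, mem_internalSet]
      exact fun e => hx.mono fun n hn => mem_iInter.1 hn e⟩
    simp only [mem_univ, iInter_true, hzero] at this
    exact lt_irrefl _ this
  have hsmall : ∀ e : {e // e ∈ H}, ∀ᶠ n in (hyperfilter ℕ : Filter ℕ),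
      ((E n e.1 \ A e n).ncard : ℝ) / Fintype.card (∀ j, V n j) < ε := by
    intro e
    refine (tendsto_density fun n => E n e.1 \ A e n).eventually_lt_const ?_
    rw [← internalSet_diff, hAG]
    exact (hFG e).trans_lt (half_lt_self hε)
  obtain ⟨n, hn, hn'⟩ :=
    ((eventually_eq_empty_of_internalSet_eq_empty hGempty).and (eventually_all.2 hsmall)).exists
  let E' : Finset J → Set (∀ j, V n j) := fun e => if h : e ∈ H then A ⟨e, h⟩ n else ∅
  have hE' : ∀ e (h : e ∈ H), E' e = A ⟨e, h⟩ n := fun e h => dif_pos h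
  obtain ⟨e, he, hlt⟩ := hbad n E' (fun e he => by rw [hE' e he]; exact hA ⟨e, he⟩ n) (by
    rw [← hn, iInter_subtype]
    exact iInter₂_congr hE')
  rw [hE' e he] at hlt
  have := hn' ⟨e, he⟩
  rw [div_lt_iff₀ (by exact_mod_cast Fintype.card_pos)] at this
  exact lt_asymm hlt this

/-! ### Transfer to arbitrary index sets, and the rate function -/

theorem ncard_preimage_restrict {J : Type*} [Fintype J] [DecidableEq J] {V : J → Type*}
    [∀ j, Fintype (V j)] (e : Finset J) (S : Set (∀ j : {j // j ∈ e}, V j.1)) :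
    {x : ∀ j, V j | (fun j : {j // j ∈ e} => x j.1) ∈ S}.ncard =
      S.ncard * ∏ j ∈ eᶜ, Fintype.card (V j) := by
  have h : (Equiv.piEquivPiSubtypeProd (· ∈ e) V) ''
      {x : ∀ j, V j | (fun j : {j // j ∈ e} => x j.1) ∈ S} =
      S ×ˢ (univ : Set (∀ j : {j // j ∉ e}, V j.1)) := by
    rw [Equiv.image_eq_preimage_symm]
    ext p
    simp only [mem_preimage, mem_prod, mem_univ, and_true]
    have : (fun j : {j // j ∈ e} => (Equiv.piEquivPiSubtypeProd (· ∈ e) V).symm p j.1) = p.1 :=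
      congrArg Prod.fst ((Equiv.piEquivPiSubtypeProd (· ∈ e) V).apply_symm_apply p)
    rw [← this]
    rfl
  rw [← ncard_image_of_injective _ (Equiv.piEquivPiSubtypeProd (· ∈ e) V).injective, h, ncard_prod,
    ncard_univ, Nat.card_eq_fintype_card, Fintype.card_pi]
  congr 1
  rw [Finset.prod_subtype (p := (· ∉ e)) eᶜ (by simp)]

/-- The conclusion of the removal lemma for hypergraphs on `n` vertex classes whose density of
copies is at most `δ`, with edge loss `ε`. -/
def RemovalHolds (n : ℕ) (ε δ : ℝ) : Prop :=
  ∀ (J : Type u) [Fintype J] (V : J → Type v) [∀ j, Fintype (V j)] [∀ j, Nonempty (V j)]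
    (d : ℕ) (H : Finset (Finset J)), Fintype.card J = n → (∀ e ∈ H, e.card = d) → H.Nonempty →
    ∀ E : ∀ e : {e : Finset J // e ∈ H}, Set (∀ j : {j : J // j ∈ e.1}, V j.1),
    ((hypergraphCopies H E).ncard : ℝ) ≤ δ * ∏ j, (Fintype.card (V j) : ℝ) →
    ∃ E' : ∀ e : {e : Finset J // e ∈ H}, Set (∀ j : {j : J // j ∈ e.1}, V j.1),
      hypergraphCopies H E' = ∅ ∧
      ∀ e : {e : Finset J // e ∈ H},
        ((E e \ E' e).ncard : ℝ) ≤ ε * ∏ j ∈ e.1, (Fintype.card (V j) : ℝ)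

/-- Deleting every edge always works, so the infimum defining the rate is over a nonempty set. -/
theorem removalHolds_one (n : ℕ) (δ : ℝ) : RemovalHolds.{u, v} n 1 δ := by
  classical
  intro J _ V _ _ d H _ _ hne E _
  refine ⟨fun _ => ∅, ?_, fun e => ?_⟩
  · obtain ⟨e, he⟩ := hne
    exact eq_empty_of_forall_notMem fun x hx => hx ⟨e, he⟩
  · have : (E e).ncard ≤ ∏ j ∈ e.1, Fintype.card (V j) := by
      refine (ncard_le_ncard (subset_univ _) finite_univ).trans_eq ?_
      rw [ncard_univ, Nat.card_eq_fintype_card, Fintype.card_pi]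
      exact (Finset.prod_subtype e.1 (fun _ => Iff.rfl) fun j => Fintype.card (V j)).symm
    rw [sdiff_empty, one_mul]
    exact_mod_cast this

theorem exists_removalHolds (n : ℕ) {ε : ℝ} (hε : 0 < ε) :
    ∃ δ₀ : ℝ, 0 < δ₀ ∧ ∀ δ ≤ δ₀, RemovalHolds.{u, v} n ε δ := by
  classical
  -- Up to relabeling vertices there are finitely many patterns on `n` classes, so the least of
  -- their constants serves all of them.
  have hfin : ∀ p : Finset (Finset (Fin n)) × Fin (n + 1), ∃ δ : ℝ, 0 < δ ∧
      ((∀ e ∈ p.1, e.card = p.2) →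
      ∀ (V : Fin n → Type v) [∀ j, Fintype (V j)] [∀ j, Nonempty (V j)]
        (E : Finset (Fin n) → Set (∀ j, V j)), (∀ e ∈ p.1, IsCylinder e (E e)) →
        ((⋂ e ∈ p.1, E e).ncard : ℝ) ≤ δ * Fintype.card (∀ j, V j) →
        ∃ E' : Finset (Fin n) → Set (∀ j, V j), (∀ e ∈ p.1, IsCylinder e (E' e)) ∧
          ⋂ e ∈ p.1, E' e = ∅ ∧
          ∀ e ∈ p.1, ((E e \ E' e).ncard : ℝ) ≤ ε * Fintype.card (∀ j, V j)) := by
    intro p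
    by_cases hp : ∀ e ∈ p.1, e.card = p.2
    · obtain ⟨δ, hδ, h⟩ := exists_cylinder_removal.{v} hp hε
      exact ⟨δ, hδ, fun _ => h⟩
    · exact ⟨1, one_pos, fun h => absurd h hp⟩
  choose δ hδ hrem using hfin
  obtain ⟨p₀, hp₀⟩ := Finite.exists_min δ
  refine ⟨δ p₀, hδ p₀, fun δ' hδ' => ?_⟩
  intro J _ V _ _ d H hJ hHd hne E hcount
  let σ : J ≃ Fin n := (Fintype.equivFin J).trans (finCongr hJ)
  let Φ := Equiv.piCongrLeft' V σ
  have hΦ : ∀ x i, Φ x i = x (σ.symm i) := fun _ _ => rfl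
  have hdn : d < n + 1 := by
    obtain ⟨e, he⟩ := hne
    rw [← hHd e he, ← hJ]
    exact Nat.lt_succ_of_le (Finset.card_le_univ e)
  let H' : Finset (Finset (Fin n)) := H.image fun e => e.map σ.toEmbedding
  let S : Finset (Fin n) → Set (∀ i, V (σ.symm i)) := fun e' =>
    {y | ∀ e (he : e ∈ H), e.map σ.toEmbedding = e' →
      (fun j : {j // j ∈ e} => Φ.symm y j.1) ∈ E ⟨e, he⟩}
  have hS : ∀ e (he : e ∈ H) x, Φ x ∈ S (e.map σ.toEmbedding) ↔
      (fun j : {j // j ∈ e} => x j.1) ∈ E ⟨e, he⟩ := by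
    intro e he x
    constructor
    · intro h
      have := h e he rfl
      rwa [Equiv.symm_apply_apply] at this
    · intro h e₂ he₂ heq
      obtain rfl := Finset.map_injective _ heq
      rwa [Equiv.symm_apply_apply]
  have hcopies : Φ '' hypergraphCopies H E = ⋂ e ∈ H', S e := by
    ext y
    obtain ⟨x, rfl⟩ := Φ.surjective y
    rw [Φ.injective.mem_set_image]
    simp only [H', mem_iInter, Finset.mem_image, forall_exists_index, and_imp,
      forall_apply_eq_imp_iff₂]
    exact ⟨fun h e he => (hS e he x).2 (h ⟨e, he⟩), fun h e => (hS e.1 e.2 x).1 (h e.1 e.2)⟩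
  have hcard : Fintype.card (∀ i, V (σ.symm i)) = ∏ j, Fintype.card (V j) := by
    rw [← Fintype.card_congr Φ, Fintype.card_pi]
  have hagree : ∀ (e : Finset J) (x x' : ∀ j, V j), (∀ j ∈ e, x j = x' j) →
      ∀ i ∈ e.map σ.toEmbedding, Φ x i = Φ x' i := by
    intro e x x' h i hi
    obtain ⟨j, hj, rfl⟩ := Finset.mem_map.1 hi
    rw [hΦ, hΦ]
    refine h _ ?_
    simpa using hj
  have hagree' : ∀ (e : Finset J) (x x' : ∀ j, V j),
      (∀ i ∈ e.map σ.toEmbedding, Φ x i = Φ x' i) → ∀ j ∈ e, x j = x' j := by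
    intro e x x' h j hj
    have := h (σ j) (Finset.mem_map_of_mem _ hj)
    rw [hΦ, hΦ] at this
    rwa [σ.symm_apply_apply] at this
  obtain ⟨E₂, hE₂, hE₂empty, hE₂small⟩ := hrem (H', ⟨d, hdn⟩)
    (by
      intro e' he'
      obtain ⟨e, he, rfl⟩ := Finset.mem_image.1 he'
      simpa using hHd e he)
    (fun i => V (σ.symm i)) S
    (by
      intro e' he' y y' hyy' hy
      obtain ⟨e, he, rfl⟩ := Finset.mem_image.1 he'
      obtain ⟨x, rfl⟩ := Φ.surjective y
      obtain ⟨x', rfl⟩ := Φ.surjective y'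
      rw [hS e he] at hy ⊢
      have := hagree' e x x' hyy'
      rwa [show (fun j : {j // j ∈ e} => x' j.1) = fun j : {j // j ∈ e} => x j.1 from
        funext fun j => (this j.1 j.2).symm])
    (by
      rw [← hcopies, ncard_image_of_injective _ Φ.injective, hcard]
      push_cast
      refine hcount.trans ?_
      gcongr
      exact hδ'.trans (hp₀ _))
  -- The new edge set is the projection of the cylinder `E₂` to the coordinates in `e`; being a
  -- cylinder, `E₂` is recovered from it.
  refine ⟨fun e => {z | ∃ x : ∀ j, V j, (fun j : {j // j ∈ e.1} => x j.1) = z ∧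
    Φ x ∈ E₂ (e.1.map σ.toEmbedding)}, ?_, fun e => ?_⟩
  · refine eq_empty_of_forall_notMem fun x hx => ?_
    have : Φ x ∈ ⋂ e ∈ H', E₂ e := by
      refine mem_iInter₂.2 fun e' he' => ?_
      have he'' := he'
      obtain ⟨e, he, rfl⟩ := Finset.mem_image.1 he''
      obtain ⟨x', hx', hx'E⟩ := hx ⟨e, he⟩
      exact hE₂ _ he' (hagree e x' x fun j hj => congrFun hx' ⟨j, hj⟩) hx'E
    rw [hE₂empty] at this
    exact this
  · set B : Set (∀ j : {j : J // j ∈ e.1}, V j.1) := E e \ {z | ∃ x : ∀ j, V j,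
      (fun j : {j // j ∈ e.1} => x j.1) = z ∧ Φ x ∈ E₂ (e.1.map σ.toEmbedding)} with hB
    have hsub : Φ '' {x : ∀ j, V j | (fun j : {j // j ∈ e.1} => x j.1) ∈ B} ⊆
        S (e.1.map σ.toEmbedding) \ E₂ (e.1.map σ.toEmbedding) := by
      rintro _ ⟨x, hx, rfl⟩
      exact ⟨(hS e.1 e.2 x).2 hx.1, fun h => hx.2 ⟨x, rfl, h⟩⟩
    -- All fibers of the restriction to `e` have the same size, which cancels from both sides.
    have h1 := ncard_le_ncard hsub (toFinite _)
    rw [ncard_image_of_injective _ Φ.injective, ncard_preimage_restrict] at h1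
    have h2 := hE₂small _ (Finset.mem_image_of_mem _ e.2)
    rw [hcard, ← Finset.prod_mul_prod_compl e.1] at h2
    have h3 : (0 : ℝ) < ∏ j ∈ e.1ᶜ, (Fintype.card (V j) : ℝ) :=
      Finset.prod_pos fun j _ => by exact_mod_cast Fintype.card_pos
    have h4 : (B.ncard : ℝ) * ∏ j ∈ e.1ᶜ, (Fintype.card (V j) : ℝ) ≤
        (ε * ∏ j ∈ e.1, (Fintype.card (V j) : ℝ)) * ∏ j ∈ e.1ᶜ, (Fintype.card (V j) : ℝ) := by
      calc (B.ncard : ℝ) * ∏ j ∈ e.1ᶜ, (Fintype.card (V j) : ℝ) ≤ _ := by exact_mod_cast h1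
        _ ≤ _ := h2
        _ = _ := by push_cast; ring
    exact le_of_mul_le_mul_right h4 h3

theorem corollary1p6 :
    ∃ c : ℕ → ℝ → ℝ,
      (∀ n : ℕ, Tendsto (c n) (𝓝[>] 0) (𝓝 0)) ∧
      ∀ (J : Type*) [Fintype J]
        (V : J → Type*) [∀ j, Fintype (V j)] [∀ j, Nonempty (V j)]
        (d : ℕ) (_ : d ≤ Fintype.card J)
        (H : Finset (Finset J)) (_ : H ⊆ (Finset.univ : Finset J).powersetCard d)
        (_ : H.Nonempty)
        (E : ∀ e : {e : Finset J // e ∈ H}, Set (∀ j : {j : J // j ∈ e.1}, V j.1))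
        (δ : ℝ) (_ : 0 < δ) (_ : δ ≤ 1)
        (_ : ((hypergraphCopies H E).ncard : ℝ) ≤ δ * ∏ j, (Fintype.card (V j) : ℝ)),
        ∃ E' : ∀ e : {e : Finset J // e ∈ H}, Set (∀ j : {j : J // j ∈ e.1}, V j.1),
          hypergraphCopies H E' = ∅ ∧
          ∀ e : {e : Finset J // e ∈ H},
            ((E e \ E' e).ncard : ℝ) ≤
              c (Fintype.card J) δ * ∏ j ∈ e.1, (Fintype.card (V j) : ℝ) := by
  have hbdd : ∀ n δ, BddBelow {ε : ℝ | 0 ≤ ε ∧ RemovalHolds n ε δ} := fun n δ =>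
    ⟨0, fun ε hε => hε.1⟩
  have hne : ∀ n δ, {ε : ℝ | 0 ≤ ε ∧ RemovalHolds n ε δ}.Nonempty := fun n δ =>
    ⟨1, zero_le_one, removalHolds_one n δ⟩
  -- The infimum need not be attained; adding `δ` puts an admissible loss strictly below the rate
  -- and still tends to zero.
  refine ⟨fun n δ => sInf {ε : ℝ | 0 ≤ ε ∧ RemovalHolds n ε δ} + δ, fun n => ?_, ?_⟩
  · rw [Metric.tendsto_nhds]
    intro ε hε
    obtain ⟨δ₀, hδ₀, h⟩ := exists_removalHolds n (half_pos hε)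
    filter_upwards [Ioo_mem_nhdsGT (lt_min hδ₀ (half_pos hε))] with δ hδ
    have h1 := csInf_le (hbdd n δ) ⟨(half_pos hε).le, h δ (hδ.2.le.trans (min_le_left _ _))⟩
    have h2 : 0 ≤ sInf {ε : ℝ | 0 ≤ ε ∧ RemovalHolds n ε δ} := Real.sInf_nonneg fun _ hx => hx.1
    have h3 := hδ.2.trans_le (min_le_right _ _)
    have h4 := hδ.1
    rw [Real.dist_eq, sub_zero, abs_of_nonneg (by positivity)]
    linarith
  · intro J _ V _ _ d _ H hH hHne E δ hδ _ hcount
    obtain ⟨ε, ⟨-, hε⟩, hlt⟩ := exists_lt_of_csInf_lt (hne (Fintype.card J) δ)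
      (lt_add_of_pos_right (sInf {ε : ℝ | 0 ≤ ε ∧ RemovalHolds (Fintype.card J) ε δ}) hδ)
    obtain ⟨E', hE', hsmall⟩ := hε J V d H rfl
      (fun e he => (Finset.mem_powersetCard.1 (hH he)).2) hHne E hcount
    refine ⟨E', hE', fun e => (hsmall e).trans ?_⟩
    gcongr
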